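/- Let $\mathbb{K}$ be a field and $S=\mathbb{K}[x_1,\dots,x_n]$, let $\mathfrak m=(x_1,\dots,x_n)$, and let $I\subseteq S$ be a monomial ideal with set of minimal monomial generators $G(I)$. Suppose that $I$ is weakly polymatroidal: whenever $u=x_1^{a_1}\cdots x_n^{a_n}$ and $v=x_1^{b_1}\cdots x_n^{b_n}$ in $G(I)$ satisfy $a_1=b_1,\dots,a_{t-1}=b_{t-1}$ and $a_t>b_t$ for some $t$, there is $j>t$ such that $x_j$ divides $v$ and $x_t(v/x_j)\in I$. Suppose also that all elements of $G(I)$ have the same degree. Let $\ell(I)$ be the analytic spread of $I$, that is, the Krull dimension of $\mathcal R(I)/\mathfrak m\mathcal R(I)$, where $\mathcal R(I)$ is the Rees algebra of $I$; let $\operatorname{depth}(M)$ denote the greatest length of an $M$-regular sequence contained in $\mathfrak m$. For a finitely generated $\mathbb{Z}^n$-graded $S$-module $M\neq 0$, let $\operatorname{sdepth}(M)$ denote its Stanley depth: the maximum, over all decompositions of $M$ as a finite direct sum of $\mathbb{K}$-subspaces $u_i\mathbb{K}[Z_i]$ with $u_i\in M$ homogeneous, $Z_i\subseteq\{x_1,\dots,x_n\}$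 and $u_i\mathbb{K}[Z_i]$ free over $\mathbb{K}[Z_i]$ with basis $u_i$, of $\min_i|Z_i|$. Then $\ell(I)$ is finite, and: (i) $\operatorname{sdepth}(I)\ge n-\ell(I)+1$ if $I\neq 0$, and $\operatorname{sdepth}(S/I)\ge n-\ell(I)$ if $I\neq S$; (ii) $\operatorname{depth}(S/I)\ge n-\ell(I)$ if $I\neq S$. -/

import Mathlib

noncomputable section

open MvPolynomial

namespace StanleyDepth

/-! Throughout, `S = MvPolynomial (Fin n) K` is the polynomial ring `K[x_1, …, x_n]`, with the
variables in their usual order, and `monomial a 1` is the monomial `x^a`. -/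

section Graded

variable {K : Type*} [Field K] {n : ℕ}
variable {M : Type*} [AddCommGroup M] [Module K M] [Module (MvPolynomial (Fin n) K) M]
  [IsScalarTower K (MvPolynomial (Fin n) K) M]

/-- The `K`-subspace `u K[Z]` of the `S`-module `M`: all products `f • u` with `f ∈ K[Z]`, the
subalgebra of polynomials in which only the variables of `Z` occur. -/
def stanleySpace (u : M) (Z : Finset (Fin n)) : Submodule K M :=
  (Subalgebra.toSubmodule (MvPolynomial.supported K (Z : Set (Fin n)))).map
    ((LinearMap.toSpanSingleton (MvPolynomial (Fin n) K) M u).restrictScalars K)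

/-- `u K[Z]` is free over `K[Z]` with basis `u`. -/
def IsFreeOn (u : M) (Z : Finset (Fin n)) : Prop :=
  ∀ f ∈ MvPolynomial.supported K (Z : Set (Fin n)), f • u = 0 → f = 0

/-- A Stanley decomposition of a `ℤ^n`-graded `S`-module `M` with homogeneous components `𝓜 a`:
finitely many Stanley spaces `u_i K[Z_i]`, each with `u_i` homogeneous and free over `K[Z_i]`,
whose internal direct sum, as vector spaces over `K`, is `M`. -/
structure StanleyDecomposition (𝓜 : (Fin n → ℤ) → Submodule K M) where
  /-- the number of Stanley spaces -/
  size : ℕ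
  /-- the homogeneous elements `u_i` -/
  u : Fin size → M
  /-- the sets of variables `Z_i` -/
  Z : Fin size → Finset (Fin n)
  homogeneous : ∀ i, ∃ a : Fin n → ℤ, u i ∈ 𝓜 a
  free : ∀ i, IsFreeOn (K := K) (u i) (Z i)
  isInternal : DirectSum.IsInternal fun i => stanleySpace (K := K) (u i) (Z i)

/-- The Stanley depth of a decomposition: the least dimension `|Z_i|` of its Stanley spaces. -/
def StanleyDecomposition.sdepth {𝓜 : (Fin n → ℤ) → Submodule K M}
    (D : StanleyDecomposition 𝓜) : ℕ∞ :=
  ⨅ i, ((D.Z i).card : ℕ∞)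

/-- The Stanley depth of a `ℤ^n`-graded `S`-module: the maximum of the Stanley depths of its
Stanley decompositions. For `M ≠ 0` every decomposition has at least one Stanley space, so that
all the numbers here are at most `n`. -/
def sdepth (𝓜 : (Fin n → ℤ) → Submodule K M) : ℕ∞ :=
  ⨆ D : StanleyDecomposition 𝓜, D.sdepth

end Graded

section Ideals

variable {K : Type*} [Field K] {n : ℕ}

/-- The component of `S` of degree `a ∈ ℤ^n`: the line spanned by `x^a`, or `0` if `a` has a
negative entry. -/
def component (a : Fin n → ℤ) : Submodule K (MvPolynomial (Fin n) K) :=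
  Submodule.span K {p | ∃ b : Fin n →₀ ℕ, (∀ i, (b i : ℤ) = a i) ∧ p = monomial b 1}

/-- The `ℤ^n`-grading of an ideal `I` (for `I` monomial): `I_a = I ∩ S_a`. -/
def idealGrading (I : Ideal (MvPolynomial (Fin n) K)) (a : Fin n → ℤ) : Submodule K I :=
  (component a).comap ((Submodule.subtype I).restrictScalars K)

/-- The `ℤ^n`-grading of `S/I` (for `I` monomial): `(S/I)_a` is the image of `S_a`. -/
def quotientGrading (I : Ideal (MvPolynomial (Fin n) K)) (a : Fin n → ℤ) :
    Submodule K (MvPolynomial (Fin n) K ⧸ I) :=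
  (component a).map ((Submodule.mkQ I).restrictScalars K)

/-- The Stanley depth `sdepth(I)` of a monomial ideal `I`. -/
def sdepthIdeal (I : Ideal (MvPolynomial (Fin n) K)) : ℕ∞ := sdepth (idealGrading I)

/-- The Stanley depth `sdepth(S/I)` for a monomial ideal `I`. -/
def sdepthQuotient (I : Ideal (MvPolynomial (Fin n) K)) : ℕ∞ := sdepth (quotientGrading I)

variable (K n) in
/-- The graded maximal ideal `𝔪 = (x_1, …, x_n)`. -/
def gradedMaximalIdeal : Ideal (MvPolynomial (Fin n) K) :=
  Ideal.span (Set.range fun i : Fin n => (X i : MvPolynomial (Fin n) K))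

variable (K n) in
/-- The depth of an `S`-module `M ≠ 0`: the greatest length of an `M`-regular sequence in `𝔪`. -/
def depth (M : Type*) [AddCommGroup M] [Module (MvPolynomial (Fin n) K) M] : ℕ∞ :=
  ⨆ (rs : List (MvPolynomial (Fin n) K))
    (_ : (∀ r ∈ rs, r ∈ gradedMaximalIdeal K n) ∧ RingTheory.Sequence.IsRegular M rs),
    (rs.length : ℕ∞)

/-- The fibre ring `R(I)/𝔪R(I)`, where `R(I)` is the Rees algebra of `I`. -/
abbrev FibreRing (I : Ideal (MvPolynomial (Fin n) K)) : Type _ :=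
  reesAlgebra I ⧸
    (gradedMaximalIdeal K n).map (algebraMap (MvPolynomial (Fin n) K) (reesAlgebra I))

/-- The analytic spread `ℓ(I)`: the Krull dimension of the fibre ring. -/
def analyticSpread (I : Ideal (MvPolynomial (Fin n) K)) : WithBot ℕ∞ :=
  ringKrullDim (FibreRing I)

/-- `I` is generated by monomials. -/
def IsMonomialIdeal (I : Ideal (MvPolynomial (Fin n) K)) : Prop :=
  ∃ A : Set (Fin n →₀ ℕ), I = Ideal.span ((fun a => (monomial a 1 : MvPolynomial (Fin n) K)) '' A)

/-- The exponent vectors of the minimal monomial generators `G(I)`: the monomials in `I` that are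
minimal under divisibility (the order on exponents is the componentwise one). -/
def minimalGenerators (I : Ideal (MvPolynomial (Fin n) K)) : Set (Fin n →₀ ℕ) :=
  {a | Minimal (fun b : Fin n →₀ ℕ => (monomial b 1 : MvPolynomial (Fin n) K) ∈ I) a}

/-- `I` is weakly polymatroidal: it is a monomial ideal, and whenever `x^a, x^b ∈ G(I)` agree in
the exponents before `t` and `a_t > b_t`, there is `j > t` with `x_t (x^b / x_j) ∈ I` (so `x_j`
divides `x^b`). -/
def IsWeaklyPolymatroidal (I : Ideal (MvPolynomial (Fin n) K)) : Prop :=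
  IsMonomialIdeal I ∧
    ∀ a ∈ minimalGenerators I, ∀ b ∈ minimalGenerators I, ∀ t : Fin n,
      (∀ i < t, a i = b i) → b t < a t →
        ∃ j, t < j ∧ 0 < b j ∧
          (monomial (Finsupp.single t 1 + (b - Finsupp.single j 1)) 1 :
            MvPolynomial (Fin n) K) ∈ I

/-- All minimal monomial generators of `I` have the same degree. -/
def GeneratedInSingleDegree (I : Ideal (MvPolynomial (Fin n) K)) : Prop :=
  ∃ d : ℕ, ∀ a ∈ minimalGenerators I, Finsupp.degree a = d

end Ideals

end StanleyDepth

end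

/-!
Let `G` be the set of exponent vectors of the minimal generators of `I`. As they all have the same
degree, the exchange property holds inside `G`, and it shows that `I` has linear quotients in the
lexicographic order: for `b ∈ G`, the colon ideal of `x^b` by the lexicographically larger
generators is generated by the variables `x_t` with `t ∈ liftable G b`
(`mul_monomial_mem_monomialIdeal`). Let `q` be the largest number of variables that occur. (If
`G` is empty, then `I = 0`, and `q + 1` is to be read as `0`.)

*Analytic spread.* For `t ∈ liftable G b` some vector `b + e_t - e_j` with `j > t` lies in `G`. The
differences `e_t - e_j` are triangular, so `b` and these vectors are affinely independent, and the
corresponding elements `x^a t` of the Rees algebra have algebraically independent classes in the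
fibre ring (`algebraicIndependent_fibreRing`). A finitely generated algebra over a field has Krull
dimension at least the number of algebraically independent elements in it, whence `q + 1 ≤ ℓ(I)`
(`card_liftable_add_one_le`). It remains to bound the three invariants in terms of `q`.

*Stanley depth.* Every monomial `x^e ∈ I` lies in exactly one of the Stanley spaces `x^b K[Z]` with
`Z` the complement of `liftable G b`: take for `b` the lexicographically largest element of `G` with
`b ≤ e`. If `x^e ∉ I`, the same greedy choice works for the coordinates before `k`, where `k` is the
first coordinate at which no element of `G` satisfies the bounds up to and including `k`. Fixing the
coordinate `k` as well gives a Stanley decomposition of `S/I` into spaces of dimension at least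
`n - q - 1` (`ExchangeProperty.isBoxPartition_compl_upset`).

*Depth.* Adjoining the generators in lexicographically decreasing order gives exact sequences
`0 → S/(x_t : t ∈ liftable G b) → S/J → S/(J + (x^b)) → 0`. The long exact sequences of
`Ext(K, -)` show that `Ext^i(K, S/I) = 0` for `i < n - q - 1` (`extVanishes_monomialIdeal`), and by
the theorem of Rees there is an `S/I`-regular sequence of that length in `𝔪`.
-/

open MvPolynomial

namespace StanleyDepth

section Combinatorics

variable {n : ℕ}

/-! ### Exchange in sets of exponent vectors -/

/-- The exponent vector of `x_t (x^b / x_j)`. The subtraction is truncated, so this has the intended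
meaning only if `0 < b j`. -/
noncomputable def raise (b : Fin n →₀ ℕ) (t j : Fin n) : Fin n →₀ ℕ :=
  Finsupp.single t 1 + (b - Finsupp.single j 1)

theorem raise_apply_self (b : Fin n →₀ ℕ) {t j : Fin n} (h : t < j) : raise b t j t = b t + 1 := by
  simp [raise, h.ne', add_comm]

theorem raise_apply_of_lt (b : Fin n →₀ ℕ) {i t j : Fin n} (hi : i < t) (h : t < j) :
    raise b t j i = b i := by
  simp [raise, hi.ne', (hi.trans h).ne']

theorem raise_apply_le (b : Fin n →₀ ℕ) {i t : Fin n} (j : Fin n) (hi : i ≠ t) :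
    raise b t j i ≤ b i := by
  simp [raise, Finsupp.single_apply, hi.symm]

theorem degree_raise (b : Fin n →₀ ℕ) (t : Fin n) {j : Fin n} (hj : 0 < b j) :
    (raise b t j).degree = b.degree := by
  have h : Finsupp.single j 1 ≤ b := by
    rw [Finsupp.single_le_iff]; omega
  have h2 : (b - Finsupp.single j 1).degree + 1 = b.degree := by
    conv_rhs => rw [← tsub_add_cancel_of_le h]
    simp
  rw [raise, map_add, Finsupp.degree_single, ← h2, add_comm]

theorem toLex_lt_raise (b : Fin n →₀ ℕ) {t j : Fin n} (h : t < j) :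
    toLex b < toLex (raise b t j) := by
  rw [Finsupp.Lex.lt_iff]
  refine ⟨t, fun i hi => ?_, ?_⟩
  · simp [raise_apply_of_lt b hi h]
  · simp [raise_apply_self b h]

/-- The exchange property of a set of exponent vectors: that of weakly polymatroidal ideals, with
membership in the ideal replaced by membership in the set itself. The two agree for the minimal
generators of an ideal generated in a single degree. -/
def ExchangeProperty (G : Set (Fin n →₀ ℕ)) : Prop :=
  ∀ a ∈ G, ∀ b ∈ G, ∀ t, (∀ i < t, a i = b i) → b t < a t →
    ∃ j, t < j ∧ 0 < b j ∧ raise b t j ∈ G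

open Classical in
/-- The indices `t` such that `x_t (x^b / x_j)` lies in `G` for some `j > t` dividing `x^b`. The
variables with these indices generate the colon ideal of `x^b` by the monomials of `G` that are
lexicographically larger. -/
noncomputable def liftable (G : Set (Fin n →₀ ℕ)) (b : Fin n →₀ ℕ) : Finset (Fin n) :=
  Finset.univ.filter fun t => ∃ j, t < j ∧ 0 < b j ∧ raise b t j ∈ G

theorem mem_liftable {G : Set (Fin n →₀ ℕ)} {b : Fin n →₀ ℕ} {t : Fin n} :
    t ∈ liftable G b ↔ ∃ j, t < j ∧ 0 < b j ∧ raise b t j ∈ G := by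
  simp [liftable]

/-- There is a first coordinate at which two different vectors differ. -/
theorem exists_first_difference {a b : Fin n →₀ ℕ} {k : Fin n} (h : a k ≠ b k) :
    ∃ t ≤ k, (∀ i < t, a i = b i) ∧ a t ≠ b t := by
  induction k using WellFoundedLT.induction with
  | ind k ih =>
    by_cases hk : ∃ i < k, a i ≠ b i
    · obtain ⟨i, hi, hne⟩ := hk
      obtain ⟨t, ht, h'⟩ := ih i hi hne
      exact ⟨t, ht.trans hi.le, h'⟩
    · push Not at hk
      exact ⟨k, le_rfl, hk, h⟩

theorem ExchangeProperty.mem_liftable {G : Set (Fin n →₀ ℕ)} (hG : ExchangeProperty G)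
    {a b : Fin n →₀ ℕ} (ha : a ∈ G) (hb : b ∈ G) {t : Fin n} (h : ∀ i < t, a i = b i)
    (ht : b t < a t) : t ∈ liftable G b :=
  StanleyDepth.mem_liftable.2 (hG a ha b hb t h ht)

/-- Among the elements of `G` bounded by `c` in the coordinates before `k`, the lexicographically
largest one `b` coincides with `c` in the coordinates before `k` that can be raised. -/
theorem exists_greedy {G : Set (Fin n →₀ ℕ)} (hfin : G.Finite) (c : Fin n →₀ ℕ) (k : ℕ)
    (h : ∃ b ∈ G, ∀ i : Fin n, i.val < k → b i ≤ c i) :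
    ∃ b ∈ G, (∀ i : Fin n, i.val < k → b i ≤ c i) ∧
      (∀ t ∈ liftable G b, t.val < k → c t = b t) ∧
      ∀ a ∈ G, (∀ i : Fin n, i.val < k → a i ≤ c i) → toLex a ≤ toLex b := by
  obtain ⟨b, ⟨hbG, hbc⟩, hmax⟩ := Set.exists_max_image
    {b ∈ G | ∀ i : Fin n, i.val < k → b i ≤ c i} (fun b => toLex b)
    (hfin.subset fun b hb => hb.1) (by obtain ⟨b, hb⟩ := h; exact ⟨b, hb⟩)
  refine ⟨b, hbG, hbc, fun t ht htk => ?_, fun a ha hac => hmax a ⟨ha, hac⟩⟩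
  obtain ⟨j, htj, -, hraise⟩ := mem_liftable.1 ht
  by_contra hne
  refine (toLex_lt_raise b htj).not_ge (hmax _ ⟨hraise, fun i hi => ?_⟩)
  by_cases hit : i = t
  · subst hit
    rw [raise_apply_self b htj]
    exact lt_of_le_of_ne (hbc i hi) (Ne.symm hne)
  · exact (raise_apply_le b j hit).trans (hbc i hi)

/-- Two elements of `G` that are bounded by `c` in the coordinates before `k`, and coincide with
`c` in those that can be raised, agree in the coordinates before `k`. -/
theorem ExchangeProperty.greedy_unique {G : Set (Fin n →₀ ℕ)} (hG : ExchangeProperty G)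
    {a b c : Fin n →₀ ℕ} {k : ℕ} (ha : a ∈ G) (hb : b ∈ G)
    (hac : ∀ i : Fin n, i.val < k → a i ≤ c i) (hbc : ∀ i : Fin n, i.val < k → b i ≤ c i)
    (hac' : ∀ t ∈ liftable G a, t.val < k → c t = a t)
    (hbc' : ∀ t ∈ liftable G b, t.val < k → c t = b t) (i : Fin n) (hi : i.val < k) :
    a i = b i := by
  by_contra hne
  obtain ⟨t, hti, heq, hne⟩ := exists_first_difference hne
  have htk : t.val < k := lt_of_le_of_lt hti hi
  rcases lt_or_gt_of_ne hne with h | h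
  · have h1 := hac' t (hG.mem_liftable hb ha (fun i hi => (heq i hi).symm) h) htk
    have h2 := hbc t htk
    omega
  · have h1 := hbc' t (hG.mem_liftable ha hb heq h) htk
    have h2 := hac t htk
    omega

/-- If some element of `G` is bounded by `c` in the coordinates before `l`, then there is one that
agrees with the greedy choice `b` in the coordinates before `k ≤ l`. -/
theorem ExchangeProperty.exists_agree {G : Set (Fin n →₀ ℕ)} (hG : ExchangeProperty G)
    (hfin : G.Finite) {b c : Fin n →₀ ℕ} {k l : ℕ} (hkl : k ≤ l) (hb : b ∈ G)
    (hbc : ∀ i : Fin n, i.val < k → b i ≤ c i)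
    (hbc' : ∀ t ∈ liftable G b, t.val < k → c t = b t)
    (h : ∃ a ∈ G, ∀ i : Fin n, i.val < l → a i ≤ c i) :
    ∃ a ∈ G, (∀ i : Fin n, i.val < l → a i ≤ c i) ∧ ∀ i : Fin n, i.val < k → a i = b i := by
  obtain ⟨a, ha, hac, hac', -⟩ := exists_greedy hfin c l h
  exact ⟨a, ha, hac, hG.greedy_unique ha hb (fun i hi => hac i (hi.trans_le hkl)) hbc
    (fun t ht htk => hac' t ht (htk.trans_le hkl)) hbc'⟩

/-! ### Partitions into boxes -/

/-- The exponent vectors of the monomials in `x^c K[Z]`. -/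
def box (c : Fin n →₀ ℕ) (Z : Finset (Fin n)) : Set (Fin n →₀ ℕ) :=
  {e | c ≤ e ∧ ∀ i ∉ Z, e i = c i}

/-- The boxes `box (c i) (Z i)` are pairwise disjoint with union `B`. -/
structure IsBoxPartition {ι : Type*} (c : ι → Fin n →₀ ℕ) (Z : ι → Finset (Fin n))
    (B : Set (Fin n →₀ ℕ)) : Prop where
  mem_iff : ∀ e, e ∈ B ↔ ∃ i, e ∈ box (c i) (Z i)
  eq_of_mem : ∀ e i j, e ∈ box (c i) (Z i) → e ∈ box (c j) (Z j) → i = j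

/-- The exponent vectors of the monomials in the ideal generated by those with exponents in `G`. -/
def upset (G : Set (Fin n →₀ ℕ)) : Set (Fin n →₀ ℕ) := {e | ∃ a ∈ G, a ≤ e}

theorem ExchangeProperty.isBoxPartition_upset {G : Set (Fin n →₀ ℕ)} (hG : ExchangeProperty G)
    (hfin : G.Finite) :
    IsBoxPartition (fun b : G => b.1) (fun b : G => (liftable G b.1)ᶜ) (upset G) where
  mem_iff e := by
    constructor
    · rintro ⟨a, ha, hae⟩
      obtain ⟨b, hb, hbe, hbe', -⟩ := exists_greedy hfin e n ⟨a, ha, fun i _ => hae i⟩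
      exact ⟨⟨b, hb⟩, fun i => hbe i i.isLt, fun i hi => hbe' i (by simpa using hi) i.isLt⟩
    · rintro ⟨b, hbe, -⟩
      exact ⟨b.1, b.2, hbe⟩
  eq_of_mem e a b ha hb := Subtype.ext <| Finsupp.ext fun i =>
    hG.greedy_unique a.2 b.2 (fun i _ => ha.1 i) (fun i _ => hb.1 i)
      (fun t ht _ => ha.2 t (by simpa using ht)) (fun t ht _ => hb.2 t (by simpa using ht)) i i.isLt

/-- Index set of the boxes that partition the complement of `upset G`. The box of `(k, b, m)`
consists of the `e` with `e k = m` that are bounded below in the coordinates before `k` by the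
greedy choice `b`, while no element of `G` that agrees with `b` before `k` satisfies the bound
`e k = m`. Such a `b` matters only through its coordinates before `k`; it is made unique by taking
the lexicographically largest. -/
def gapIndex (G : Set (Fin n →₀ ℕ)) : Set (Fin n × (Fin n →₀ ℕ) × ℕ) :=
  {p | p.2.1 ∈ G ∧ ∀ a ∈ G, (∀ i < p.1, a i = p.2.1 i) → toLex a ≤ toLex p.2.1 ∧ p.2.2 < a p.1}

/-- The corner of the box with index `(k, b, m)`: it is `b` before `k`, then `m`, then zero. -/
noncomputable def gapCorner (p : Fin n × (Fin n →₀ ℕ) × ℕ) : Fin n →₀ ℕ :=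
  Finsupp.equivFunOnFinite.symm fun i => if i < p.1 then p.2.1 i else if i = p.1 then p.2.2 else 0

/-- The free directions of the box with index `(k, b, m)`. -/
noncomputable def gapFree (G : Set (Fin n →₀ ℕ)) (p : Fin n × (Fin n →₀ ℕ) × ℕ) :
    Finset (Fin n) :=
  (insert p.1 ((liftable G p.2.1).filter (· < p.1)))ᶜ

theorem mem_box_gap {G : Set (Fin n →₀ ℕ)} {k : Fin n} {b : Fin n →₀ ℕ} {m : ℕ}
    {e : Fin n →₀ ℕ} : e ∈ box (gapCorner (k, b, m)) (gapFree G (k, b, m)) ↔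
      (∀ i : Fin n, i.val < k.val → b i ≤ e i) ∧ (∀ t ∈ liftable G b, t.val < k.val → e t = b t) ∧
        e k = m := by
  simp only [box, gapCorner, gapFree, Set.mem_ofPred_eq, Finset.mem_compl, not_not,
    Finset.mem_insert, Finset.mem_filter, Fin.val_fin_lt]
  constructor
  · rintro ⟨h1, h2⟩
    refine ⟨fun i hi => ?_, fun t ht htk => ?_, ?_⟩
    · simpa [hi] using h1 i
    · simpa [htk] using h2 t (Or.inr ⟨ht, htk⟩)
    · simpa using h2 k (Or.inl rfl)
  · rintro ⟨h1, h2, rfl⟩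
    refine ⟨fun i => ?_, fun i hi => ?_⟩
    · rcases lt_trichotomy i k with h | h | h
      · simpa [h] using h1 i h
      · simp [h]
      · simp [h.not_gt, h.ne']
    · rcases hi with rfl | ⟨hi, hik⟩
      · simp
      · simpa [hik] using h2 i hi hik

theorem gapIndex_finite {G : Set (Fin n →₀ ℕ)} (hfin : G.Finite) : (gapIndex G).Finite := by
  obtain ⟨d, hd⟩ : ∃ d, ∀ b ∈ G, b.degree ≤ d := by
    obtain ⟨d, hd⟩ := (hfin.image Finsupp.degree).bddAbove
    exact ⟨d, fun b hb => hd ⟨b, hb, rfl⟩⟩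
  refine (Set.finite_univ.prod (hfin.prod (Set.finite_Iio d))).subset ?_
  rintro ⟨k, b, m⟩ ⟨hb, h⟩
  exact ⟨trivial, hb, ((h b hb fun _ _ => rfl).2).trans_le ((Finsupp.le_degree k b).trans (hd b hb))⟩

/-- At a point of a box of `gapIndex G`, no element of `G` satisfies the bounds up to `k`. -/
theorem ExchangeProperty.not_exists_le_of_mem_box {G : Set (Fin n →₀ ℕ)}
    (hG : ExchangeProperty G) (hfin : G.Finite) {k : Fin n} {b : Fin n →₀ ℕ} {m : ℕ}
    (hp : (k, b, m) ∈ gapIndex G) {e : Fin n →₀ ℕ}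
    (he : e ∈ box (gapCorner (k, b, m)) (gapFree G (k, b, m))) :
    ¬ ∃ a ∈ G, ∀ i : Fin n, i.val < k.val + 1 → a i ≤ e i := by
  intro h
  obtain ⟨h1, h2, rfl⟩ := mem_box_gap.1 he
  obtain ⟨a, ha, hae, hab⟩ := hG.exists_agree hfin (Nat.le_succ _) hp.1 h1 h2 h
  exact (hp.2 a ha fun i hi => hab i hi).2.not_ge (hae k (Nat.lt_succ_self _))

theorem ExchangeProperty.isBoxPartition_compl_upset {G : Set (Fin n →₀ ℕ)}
    (hG : ExchangeProperty G) (hfin : G.Finite) (hne : G.Nonempty) :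
    IsBoxPartition (fun p : gapIndex G => gapCorner p.1) (fun p : gapIndex G => gapFree G p.1)
      (upset G)ᶜ where
  mem_iff e := by
    constructor
    · intro he
      have hex : ∃ k, ¬ ∃ a ∈ G, ∀ i : Fin n, i.val < k → a i ≤ e i :=
        ⟨n, fun ⟨a, ha, hae⟩ => he ⟨a, ha, fun i => hae i i.isLt⟩⟩
      classical
      obtain ⟨l, hl, hmin⟩ : ∃ k, (¬ ∃ a ∈ G, ∀ i : Fin n, i.val < k → a i ≤ e i) ∧
          ∀ l < k, ∃ a ∈ G, ∀ i : Fin n, i.val < l → a i ≤ e i :=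
        ⟨Nat.find hex, Nat.find_spec hex, fun l hl => not_not.1 (Nat.find_min hex hl)⟩
      obtain _ | k := l
      · obtain ⟨a, ha⟩ := hne
        exact absurd ⟨a, ha, fun i hi => absurd hi (Nat.not_lt_zero _)⟩ hl
      have hkn : k < n := by
        by_contra hkn
        obtain ⟨a, ha, hae⟩ := hmin k (Nat.lt_succ_self k)
        exact hl ⟨a, ha, fun i _ => hae i (by omega)⟩
      obtain ⟨b, hb, hbe, hbe', hmax⟩ := exists_greedy hfin e k (hmin k (Nat.lt_succ_self k))
      refine ⟨⟨(⟨k, hkn⟩, b, e ⟨k, hkn⟩), hb, fun a ha hab => ⟨hmax a ha fun i hi => ?_, ?_⟩⟩,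
        mem_box_gap.2 ⟨hbe, hbe', rfl⟩⟩
      · exact (hab i hi).trans_le (hbe i hi)
      · by_contra hlt
        refine hl ⟨a, ha, fun i hi => ?_⟩
        rcases Nat.lt_succ_iff_lt_or_eq.1 hi with h | h
        · exact (hab i h).trans_le (hbe i h)
        · obtain rfl : i = ⟨k, hkn⟩ := Fin.ext h
          exact not_lt.1 hlt
    · rintro ⟨⟨⟨k, b, m⟩, hp⟩, he⟩ ⟨a, ha, hae⟩
      exact hG.not_exists_le_of_mem_box hfin hp he ⟨a, ha, fun i _ => hae i⟩
  eq_of_mem e := by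
    rintro ⟨⟨k, b, m⟩, hp⟩ ⟨⟨k', b', m'⟩, hp'⟩ he he'
    have hk : k = k' := by
      have h1 := hG.not_exists_le_of_mem_box hfin hp he
      have h2 := hG.not_exists_le_of_mem_box hfin hp' he'
      have h3 := (mem_box_gap.1 he).1
      have h4 := (mem_box_gap.1 he').1
      rcases lt_trichotomy k k' with h | h | h
      · exact absurd ⟨b', hp'.1, fun i hi => h4 i (hi.trans_le h)⟩ h1
      · exact h
      · exact absurd ⟨b, hp.1, fun i hi => h3 i (hi.trans_le h)⟩ h2
    subst hk
    obtain ⟨h1, h2, rfl⟩ := mem_box_gap.1 he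
    obtain ⟨h1', h2', rfl⟩ := mem_box_gap.1 he'
    have hag := hG.greedy_unique hp.1 hp'.1 h1 h1' h2 h2'
    have hbb : b = b' := toLex.injective <| le_antisymm
      (hp'.2 b hp.1 fun i hi => hag i hi).1 (hp.2 b' hp'.1 fun i hi => (hag i hi).symm).1
    subst hbb
    rfl

theorem card_le_card_gapFree_add (G : Set (Fin n →₀ ℕ)) (p : Fin n × (Fin n →₀ ℕ) × ℕ) :
    n ≤ (gapFree G p).card + ((liftable G p.2.1).card + 1) := by
  have h1 : (insert p.1 ((liftable G p.2.1).filter (· < p.1))).card ≤ (liftable G p.2.1).card + 1 :=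
    (Finset.card_insert_le _ _).trans (by gcongr; exact Finset.filter_subset _ _)
  have h2 := Finset.card_add_card_compl (insert p.1 ((liftable G p.2.1).filter (· < p.1)))
  rw [Fintype.card_fin] at h2
  rw [gapFree]
  omega

end Combinatorics

section MonomialIdeals

variable {K : Type*} [Field K] {n : ℕ}

/-! ### Stanley decompositions from box partitions -/

section Module

variable {M : Type*} [AddCommGroup M] [Module K M] [Module (MvPolynomial (Fin n) K) M]
  [IsScalarTower K (MvPolynomial (Fin n) K) M]

theorem supported_eq_span_monomial (Z : Finset (Fin n)) :
    Subalgebra.toSubmodule (MvPolynomial.supported K (Z : Set (Fin n))) =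
      Submodule.span K ((fun w => (monomial w 1 : MvPolynomial (Fin n) K)) ''
        {w | ∀ i ∉ Z, w i = 0}) := by
  apply le_antisymm
  · intro f hf
    rw [Subalgebra.mem_toSubmodule, mem_supported] at hf
    rw [f.as_sum]
    refine Submodule.sum_mem _ fun w hw => ?_
    rw [← mul_one (coeff w f), ← smul_eq_mul, ← smul_monomial]
    refine Submodule.smul_mem _ _ (Submodule.subset_span ⟨w, fun i hi => ?_, rfl⟩)
    by_contra h
    exact hi (hf ((mem_vars_iff_mem_support i).2 ⟨w, hw, Finsupp.mem_support_iff.2 h⟩))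
  · rw [Submodule.span_le]
    rintro _ ⟨w, hw, rfl⟩
    rw [SetLike.mem_coe, Subalgebra.mem_toSubmodule, mem_supported, vars_monomial one_ne_zero]
    intro i hi
    by_contra h
    exact Finsupp.mem_support_iff.1 hi (hw i h)

theorem stanleySpace_eq_span (u : M) (Z : Finset (Fin n)) :
    stanleySpace (K := K) u Z = Submodule.span K
      ((fun w => (monomial w 1 : MvPolynomial (Fin n) K) • u) '' {w | ∀ i ∉ Z, w i = 0}) := by
  rw [stanleySpace, supported_eq_span_monomial, Submodule.map_span, Set.image_image]
  rfl

variable {B : Set (Fin n →₀ ℕ)} {ι : Type*} {c : ι → Fin n →₀ ℕ} {Z : ι → Finset (Fin n)}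

theorem mem_box_add {c w : Fin n →₀ ℕ} {Z : Finset (Fin n)} (hw : ∀ i ∉ Z, w i = 0) :
    c + w ∈ box c Z :=
  ⟨le_self_add, fun i hi => by simp [hw i hi]⟩

theorem exists_add_of_mem_box {c e : Fin n →₀ ℕ} {Z : Finset (Fin n)} (he : e ∈ box c Z) :
    ∃ w : Fin n →₀ ℕ, (∀ i ∉ Z, w i = 0) ∧ e = c + w :=
  ⟨e - c, fun i hi => by simp [he.2 i hi], (add_tsub_cancel_of_le he.1).symm⟩

theorem IsBoxPartition.box_subset (h : IsBoxPartition c Z B) (i : ι) : box (c i) (Z i) ⊆ B :=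
  fun e he => (h.mem_iff e).2 ⟨i, he⟩

theorem IsBoxPartition.corner_mem (h : IsBoxPartition c Z B) (i : ι) : c i ∈ B :=
  h.box_subset i ⟨le_rfl, fun _ _ => rfl⟩

theorem stanleySpace_eq_span_basis (bas : Module.Basis B K M)
    (hmul : ∀ (e e' : B) (w : Fin n →₀ ℕ), e'.1 = e.1 + w →
      (monomial w 1 : MvPolynomial (Fin n) K) • bas e = bas e')
    (h : IsBoxPartition c Z B) (i : ι) :
    stanleySpace (K := K) (bas ⟨c i, h.corner_mem i⟩) (Z i) =
      Submodule.span K (bas '' {e | e.1 ∈ box (c i) (Z i)}) := by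
  rw [stanleySpace_eq_span]
  congr 1
  ext x
  constructor
  · rintro ⟨w, hw, rfl⟩
    exact ⟨⟨c i + w, h.box_subset i (mem_box_add hw)⟩, mem_box_add hw, (hmul _ _ w rfl).symm⟩
  · rintro ⟨e, he, rfl⟩
    obtain ⟨w, hw, hew⟩ := exists_add_of_mem_box he
    exact ⟨w, hw, hmul _ _ w hew⟩

theorem isFreeOn_basis (bas : Module.Basis B K M)
    (hmul : ∀ (e e' : B) (w : Fin n →₀ ℕ), e'.1 = e.1 + w →
      (monomial w 1 : MvPolynomial (Fin n) K) • bas e = bas e')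
    (h : IsBoxPartition c Z B) (i : ι) :
    IsFreeOn (K := K) (bas ⟨c i, h.corner_mem i⟩) (Z i) := by
  intro f hf hfu
  rw [mem_supported] at hf
  have hw : ∀ w ∈ f.support, ∀ j ∉ Z i, w j = 0 := fun w hw j hj => by
    by_contra hne
    exact hj (hf ((mem_vars_iff_mem_support j).2 ⟨w, hw, Finsupp.mem_support_iff.2 hne⟩))
  let g : f.support → B := fun w => ⟨c i + w.1, h.box_subset i (mem_box_add (hw w.1 w.2))⟩
  have hg : Function.Injective g := fun w w' hww => by
    have := congrArg Subtype.val hww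
    exact Subtype.ext (add_left_cancel this)
  have hlin := bas.linearIndependent.comp g hg
  have hsum : ∑ w : f.support, coeff w.1 f • (bas ∘ g) w = 0 := by
    rw [← hfu]
    conv_rhs => rw [f.as_sum, Finset.sum_smul, ← Finset.sum_coe_sort]
    refine Finset.sum_congr rfl fun w _ => ?_
    rw [Function.comp_apply, ← hmul ⟨c i, h.corner_mem i⟩ (g w) w.1 rfl, ← smul_assoc,
      smul_monomial, smul_eq_mul, mul_one]
  have hz := Fintype.linearIndependent_iff.1 hlin _ hsum
  rw [← support_eq_empty]
  by_contra hne
  obtain ⟨w, hw'⟩ := Finset.nonempty_iff_ne_empty.2 hne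
  exact mem_support_iff.1 hw' (hz ⟨w, hw'⟩)

/-- The spans of the classes of a partition of a basis form an internal direct sum. -/
theorem isInternal_span_basis {E V : Type*} [AddCommGroup V] [Module K V] [DecidableEq ι]
    (bas : Module.Basis E K V) (T : ι → Set E) (hex : ∀ e, ∃ i, e ∈ T i)
    (hun : ∀ e i j, e ∈ T i → e ∈ T j → i = j) :
    DirectSum.IsInternal fun i => Submodule.span K (bas '' T i) := by
  apply DirectSum.isInternal_submodule_of_iSupIndep_of_iSup_eq_top
  · intro i
    rw [← Submodule.span_iUnion₂, ← Set.image_iUnion₂]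
    refine bas.linearIndependent.disjoint_span_image (Set.disjoint_left.2 fun e he he' => ?_)
    simp only [Set.mem_iUnion] at he'
    obtain ⟨j, hj, hej⟩ := he'
    exact hj (hun e j i hej he)
  · rw [← Submodule.span_iUnion, ← Set.image_iUnion, Set.iUnion_eq_univ_iff.2 hex, Set.image_univ,
      bas.span_eq]

/-- If the exponent vectors in `B` index a homogeneous `K`-basis of `M`, on which monomials act by
translation as long as they stay in `B`, then a finite partition of `B` into boxes bounds the
Stanley depth of `M` from below. -/
theorem le_sdepth_of_isBoxPartition [Finite ι] (𝓜 : (Fin n → ℤ) → Submodule K M)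
    (bas : Module.Basis B K M) (hhom : ∀ e, ∃ a, bas e ∈ 𝓜 a)
    (hmul : ∀ (e e' : B) (w : Fin n →₀ ℕ), e'.1 = e.1 + w →
      (monomial w 1 : MvPolynomial (Fin n) K) • bas e = bas e')
    (h : IsBoxPartition c Z B) {k : ℕ∞} (hk : ∀ i, k ≤ (Z i).card) : k ≤ sdepth 𝓜 := by
  obtain ⟨N, ⟨e⟩⟩ := Finite.exists_equiv_fin ι
  let D : StanleyDecomposition 𝓜 :=
    { size := N
      u := fun i => bas ⟨c (e.symm i), h.corner_mem _⟩
      Z := fun i => Z (e.symm i)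
      homogeneous := fun i => hhom _
      free := fun i => isFreeOn_basis bas hmul h _
      isInternal := by
        simp_rw [stanleySpace_eq_span_basis bas hmul h]
        refine isInternal_span_basis bas (fun i : Fin N => {x | x.1 ∈ box (c (e.symm i)) (Z (e.symm i))})
          (fun x => ?_) fun x i j hi hj => ?_
        · obtain ⟨i, hi⟩ := (h.mem_iff x.1).1 x.2
          exact ⟨e i, by simpa using hi⟩
        · exact e.symm.injective (h.eq_of_mem x.1 _ _ hi hj) }
  exact le_trans (le_iInf fun i => hk (e.symm i)) (le_iSup StanleyDecomposition.sdepth D)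

end Module

/-! ### Monomial ideals and their bases -/

/-- The exponent vectors of the monomials in `I`. -/
def exponents (I : Ideal (MvPolynomial (Fin n) K)) : Set (Fin n →₀ ℕ) :=
  {e | (monomial e 1 : MvPolynomial (Fin n) K) ∈ I}

theorem IsMonomialIdeal.mem_iff {I : Ideal (MvPolynomial (Fin n) K)} (hI : IsMonomialIdeal I)
    {f : MvPolynomial (Fin n) K} : f ∈ I ↔ ∀ e ∈ f.support, e ∈ exponents I := by
  classical
  obtain ⟨A, rfl⟩ := hI
  rw [mem_ideal_span_monomial_image]
  refine forall₂_congr fun e _ => ?_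
  rw [exponents, Set.mem_ofPred_eq, mem_ideal_span_monomial_image,
    support_monomial, if_neg one_ne_zero]
  simp

theorem component_monomial_mem (e : Fin n →₀ ℕ) :
    (monomial e 1 : MvPolynomial (Fin n) K) ∈ component (fun i => (e i : ℤ)) :=
  Submodule.subset_span ⟨e, fun _ => rfl, rfl⟩

theorem linearIndependent_monomial :
    LinearIndependent K (fun e : Fin n →₀ ℕ => (monomial e 1 : MvPolynomial (Fin n) K)) := by
  have := (basisMonomials (Fin n) K).linearIndependent
  rwa [coe_basisMonomials] at this

/-- The monomials in a monomial ideal form a basis. -/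
noncomputable def idealBasis {I : Ideal (MvPolynomial (Fin n) K)} (hI : IsMonomialIdeal I) :
    Module.Basis (exponents I) K I :=
  Module.Basis.mk (v := fun e => (⟨monomial e.1 1, e.2⟩ : I))
    (LinearIndependent.of_comp ((Submodule.subtype I).restrictScalars K)
      (linearIndependent_monomial.comp _ Subtype.val_injective))
    (by
      rintro ⟨f, hf⟩ -
      have h : (⟨f, hf⟩ : I) = ∑ e : f.support, coeff e.1 f •
          (⟨monomial e.1 1, hI.mem_iff.1 hf e.1 e.2⟩ : I) := by
        apply Subtype.ext
        rw [AddSubmonoidClass.coe_finsetSum]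
        refine f.as_sum.trans ?_
        rw [← Finset.sum_coe_sort]
        refine Finset.sum_congr rfl fun e _ => ?_
        change _ = coeff e.1 f • (monomial e.1 1 : MvPolynomial (Fin n) K)
        rw [smul_monomial, smul_eq_mul, mul_one]
      rw [h]
      exact Submodule.sum_mem _ fun e _ =>
        Submodule.smul_mem _ _ (Submodule.subset_span ⟨⟨e.1, hI.mem_iff.1 hf e.1 e.2⟩, rfl⟩))

/-- The residue classes of the monomials outside a monomial ideal form a basis of the quotient. -/
noncomputable def quotientBasis {I : Ideal (MvPolynomial (Fin n) K)} (hI : IsMonomialIdeal I) :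
    Module.Basis ((exponents I)ᶜ : Set (Fin n →₀ ℕ)) K (MvPolynomial (Fin n) K ⧸ I) :=
  Module.Basis.mk (v := fun e => Ideal.Quotient.mk I (monomial e.1 1))
    (by
      rw [linearIndependent_iff']
      intro s g hg e he
      have h1 : (∑ e ∈ s, monomial e.1 (g e) : MvPolynomial (Fin n) K) ∈ I := by
        rw [← Ideal.Quotient.eq_zero_iff_mem, map_sum, ← hg]
        refine Finset.sum_congr rfl fun e _ => ?_
        change _ = Ideal.Quotient.mk I (g e • monomial e.1 1)
        rw [smul_monomial, smul_eq_mul, mul_one]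
      have h2 : coeff e.1 (∑ e ∈ s, monomial e.1 (g e) : MvPolynomial (Fin n) K) = g e := by
        rw [coeff_sum, Finset.sum_eq_single e]
        · rw [coeff_monomial, if_pos rfl]
        · intro b _ hb
          rw [coeff_monomial, if_neg (fun h => hb (Subtype.ext h))]
        · exact fun h => absurd he h
      by_contra hne
      exact e.2 (hI.mem_iff.1 h1 e.1 (by rwa [mem_support_iff, h2])))
    (by
      rintro x -
      obtain ⟨f, rfl⟩ := Ideal.Quotient.mk_surjective x
      rw [f.as_sum, map_sum]
      refine Submodule.sum_mem _ fun e _ => ?_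
      rw [← mul_one (coeff e f), ← smul_eq_mul, ← smul_monomial]
      change coeff e f • Ideal.Quotient.mk I (monomial e 1) ∈ _
      refine Submodule.smul_mem _ _ ?_
      by_cases he : e ∈ exponents I
      · rw [Ideal.Quotient.eq_zero_iff_mem.2 he]
        exact Submodule.zero_mem _
      · exact Submodule.subset_span ⟨⟨e, he⟩, rfl⟩)

theorem le_sdepthIdeal {I : Ideal (MvPolynomial (Fin n) K)} (hI : IsMonomialIdeal I)
    {ι : Type*} [Finite ι] {c : ι → Fin n →₀ ℕ} {Z : ι → Finset (Fin n)}
    (h : IsBoxPartition c Z (exponents I)) {k : ℕ∞} (hk : ∀ i, k ≤ (Z i).card) :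
    k ≤ sdepthIdeal I := by
  refine le_sdepth_of_isBoxPartition _ (idealBasis hI) (fun e => ⟨fun i => (e.1 i : ℤ), ?_⟩)
    (fun e e' w he => ?_) h hk
  · rw [idealBasis, Module.Basis.mk_apply]
    exact component_monomial_mem e.1
  · rw [idealBasis, Module.Basis.mk_apply, Module.Basis.mk_apply]
    apply Subtype.ext
    change (monomial w 1 : MvPolynomial (Fin n) K) * monomial e.1 1 = monomial e'.1 1
    rw [monomial_mul, one_mul, he, add_comm]

theorem le_sdepthQuotient {I : Ideal (MvPolynomial (Fin n) K)} (hI : IsMonomialIdeal I)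
    {ι : Type*} [Finite ι] {c : ι → Fin n →₀ ℕ} {Z : ι → Finset (Fin n)}
    (h : IsBoxPartition c Z (exponents I)ᶜ) {k : ℕ∞} (hk : ∀ i, k ≤ (Z i).card) :
    k ≤ sdepthQuotient I := by
  refine le_sdepth_of_isBoxPartition _ (quotientBasis hI) (fun e => ⟨fun i => (e.1 i : ℤ), ?_⟩)
    (fun e e' w he => ?_) h hk
  · rw [quotientBasis, Module.Basis.mk_apply]
    exact ⟨_, component_monomial_mem e.1, rfl⟩
  · rw [quotientBasis, Module.Basis.mk_apply, Module.Basis.mk_apply]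
    change Ideal.Quotient.mk I ((monomial w 1 : MvPolynomial (Fin n) K) * monomial e.1 1) = _
    rw [monomial_mul, one_mul, he, add_comm]

/-! ### Minimal generators -/

theorem monomial_mem_of_mem_minimalGenerators {I : Ideal (MvPolynomial (Fin n) K)}
    {a : Fin n →₀ ℕ} (ha : a ∈ minimalGenerators I) :
    (monomial a 1 : MvPolynomial (Fin n) K) ∈ I :=
  Minimal.prop (P := fun b : Fin n →₀ ℕ => (monomial b 1 : MvPolynomial (Fin n) K) ∈ I) ha

theorem exponents_eq_upset (I : Ideal (MvPolynomial (Fin n) K)) :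
    exponents I = upset (minimalGenerators I) := by
  ext e
  constructor
  · intro he
    obtain ⟨a, hae, ha⟩ := exists_minimal_le_of_wellFoundedLT
      (fun b : Fin n →₀ ℕ => (monomial b 1 : MvPolynomial (Fin n) K) ∈ I) e he
    exact ⟨a, ha, hae⟩
  · rintro ⟨a, ha, hae⟩
    have h : (monomial e 1 : MvPolynomial (Fin n) K) = monomial (e - a) 1 * monomial a 1 := by
      rw [monomial_mul, one_mul, tsub_add_cancel_of_le hae]
    change (monomial e 1 : MvPolynomial (Fin n) K) ∈ I
    rw [h]
    exact I.mul_mem_left _ (monomial_mem_of_mem_minimalGenerators ha)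

theorem IsWeaklyPolymatroidal.exchangeProperty {I : Ideal (MvPolynomial (Fin n) K)}
    (hI : IsWeaklyPolymatroidal I) {d : ℕ} (hd : ∀ a ∈ minimalGenerators I, a.degree = d) :
    ExchangeProperty (minimalGenerators I) := by
  intro a ha b hb t hab ht
  obtain ⟨j, htj, hj, hmem⟩ := hI.2 a ha b hb t hab ht
  refine ⟨j, htj, hj, ?_⟩
  have h : raise b t j ∈ exponents I := hmem
  rw [exponents_eq_upset] at h
  obtain ⟨c, hc, hcb⟩ := h
  -- a minimal generator dividing a monomial of the same degree is equal to it
  have hdeg : (raise b t j - c).degree = 0 := by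
    have h1 : (raise b t j - c).degree + c.degree = (raise b t j).degree := by
      rw [← map_add, tsub_add_cancel_of_le hcb]
    rw [degree_raise b t hj, hd b hb, hd c hc] at h1
    omega
  have : raise b t j = c := by
    rw [← tsub_add_cancel_of_le hcb, (Finsupp.degree_eq_zero_iff _).1 hdeg, zero_add]
  exact this ▸ hc

theorem minimalGenerators_finite {I : Ideal (MvPolynomial (Fin n) K)} {d : ℕ}
    (hd : ∀ a ∈ minimalGenerators I, a.degree = d) : (minimalGenerators I).Finite :=
  (Finsupp.finite_of_degree_eq d).subset hd

theorem IsMonomialIdeal.eq_bot_iff {I : Ideal (MvPolynomial (Fin n) K)} (hI : IsMonomialIdeal I) :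
    I = ⊥ ↔ minimalGenerators I = ∅ := by
  rw [Submodule.eq_bot_iff, Set.eq_empty_iff_forall_notMem]
  constructor
  · intro h a ha
    exact one_ne_zero ((monomial_eq_zero (s := a)).1 (h _ (monomial_mem_of_mem_minimalGenerators ha)))
  · intro h f hf
    rw [← support_eq_empty, Finset.eq_empty_iff_forall_notMem]
    intro e he
    obtain ⟨a, ha, -⟩ : e ∈ upset (minimalGenerators I) := exponents_eq_upset I ▸ hI.mem_iff.1 hf e he
    exact h a ha

end MonomialIdeals

/-! ### Vanishing of Ext along a chain of ideals -/

section Ext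

universe u

open CategoryTheory Abelian

variable {R : Type u} [CommRing R]

/-- `Ext^i(N, M) = 0` for all `i < k`. For `N = R/J` with `J M ≠ M`, both finitely generated over a
Noetherian ring `R`, this means that `J` contains an `M`-regular sequence of length `k`. -/
def ExtVanishes (N : ModuleCat.{u} R) (k : ℕ) (M : Type u) [AddCommGroup M] [Module R M] : Prop :=
  ∀ i < k, Subsingleton (Ext N (ModuleCat.of R M) i)

theorem ExtVanishes.mono {N : ModuleCat.{u} R} {k l : ℕ} {M : Type u} [AddCommGroup M] [Module R M]
    (h : ExtVanishes N l M) (hkl : k ≤ l) : ExtVanishes N k M :=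
  fun i hi => h i (hi.trans_le hkl)

theorem ExtVanishes.of_shortExact {N : ModuleCat.{u} R} {k : ℕ} {A B C : Type u}
    [AddCommGroup A] [Module R A] [AddCommGroup B] [Module R B] [AddCommGroup C] [Module R C]
    (f : A →ₗ[R] B) (g : B →ₗ[R] C) (hf : Function.Injective f) (hfg : Function.Exact f g)
    (hg : Function.Surjective g) (hA : ExtVanishes N (k + 1) A) (hB : ExtVanishes N k B) :
    ExtVanishes N k C := by
  intro i hi
  let T : ShortComplex (ModuleCat.{u} R) :=
    ModuleCat.shortComplexOfCompEqZero f g hfg.linearMap_comp_eq_zero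
  have hT : T.ShortExact := ModuleCat.shortComplex_shortExact T hfg hf hg
  have zB := AddCommGrpCat.isZero_of_iff_subsingleton.mpr (hB i hi)
  have zA := AddCommGrpCat.isZero_of_iff_subsingleton.mpr (hA (i + 1) (by omega))
  exact AddCommGrpCat.subsingleton_of_isZero <| ShortComplex.Exact.isZero_of_both_zeros
    (Ext.covariant_sequence_exact₃' N hT i (i + 1) rfl) (zB.eq_zero_of_src _) (zA.eq_zero_of_tgt _)

/-- The vanishing passes along `0 → R/(J : u) → R/J → R/(J + (u)) → 0`, with a loss of one degree
on the left. -/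
theorem ExtVanishes.quotient_sup_span {N : ModuleCat.{u} R} {k : ℕ} {J C : Ideal R} {u : R}
    (hC : ∀ f, f ∈ C ↔ f * u ∈ J) (h : ExtVanishes N (k + 1) (R ⧸ C))
    (hJ : ExtVanishes N k (R ⧸ J)) : ExtVanishes N k (R ⧸ (J ⊔ Ideal.span {u})) := by
  have hle : C ≤ Submodule.comap (LinearMap.toSpanSingleton R R u) J := fun f hf => by
    simpa using (hC f).1 hf
  refine ExtVanishes.of_shortExact (Submodule.mapQ C J (LinearMap.toSpanSingleton R R u) hle)
    (Submodule.factor le_sup_left) ?_ ?_ (Submodule.factor_surjective _) h hJ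
  · rw [← LinearMap.ker_eq_bot, Submodule.ker_mapQ, ← le_bot_iff, Submodule.map_le_iff_le_comap]
    intro f hf
    rw [Submodule.mem_comap, Submodule.mem_bot, Submodule.mkQ_apply, Submodule.Quotient.mk_eq_zero]
    exact (hC f).2 (by simpa using hf)
  · intro x
    obtain ⟨f, rfl⟩ := Submodule.mkQ_surjective J x
    rw [Submodule.factor_mk, Submodule.mkQ_apply, Submodule.mkQ_apply, Submodule.Quotient.mk_eq_zero]
    constructor
    · intro hf
      obtain ⟨a, ha, b, hb, rfl⟩ := Submodule.mem_sup.1 hf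
      obtain ⟨r, rfl⟩ := Ideal.mem_span_singleton'.1 hb
      refine ⟨Submodule.Quotient.mk r, ?_⟩
      rw [Submodule.mapQ_apply, Submodule.Quotient.eq, LinearMap.toSpanSingleton_apply,
        smul_eq_mul]
      simpa using ha
    · rintro ⟨y, hy⟩
      obtain ⟨r, rfl⟩ := Submodule.mkQ_surjective C y
      rw [Submodule.mkQ_apply, Submodule.mapQ_apply, Submodule.Quotient.eq,
        LinearMap.toSpanSingleton_apply, smul_eq_mul] at hy
      rw [← sub_sub_cancel (r * u) f]
      exact Submodule.sub_mem _ (Submodule.mem_sup_right (Ideal.mem_span_singleton'.2 ⟨r, rfl⟩))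
        (Submodule.mem_sup_left hy)

end Ext

/-! ### Depth of quotients by ideals with linear quotients -/

section Depth

universe u

variable {K : Type u} [Field K] {n : ℕ}

variable (K) in
/-- The ideal generated by the monomials with exponents in `H`. -/
noncomputable def monomialIdeal (H : Set (Fin n →₀ ℕ)) : Ideal (MvPolynomial (Fin n) K) :=
  Ideal.span ((fun a => (monomial a 1 : MvPolynomial (Fin n) K)) '' H)

variable (K) in
/-- The ideal generated by the variables with indices in `A`. -/
noncomputable def variableIdeal (A : Set (Fin n)) : Ideal (MvPolynomial (Fin n) K) :=
  Ideal.span (X '' A)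

theorem mem_monomialIdeal {H : Set (Fin n →₀ ℕ)} {f : MvPolynomial (Fin n) K} :
    f ∈ monomialIdeal K H ↔ ∀ e ∈ f.support, e ∈ upset H :=
  mem_ideal_span_monomial_image

theorem mem_variableIdeal {A : Set (Fin n)} {f : MvPolynomial (Fin n) K} :
    f ∈ variableIdeal K A ↔ ∀ e ∈ f.support, ∃ i ∈ A, e i ≠ 0 :=
  mem_ideal_span_X_image

theorem mul_X_mem_variableIdeal {A : Set (Fin n)} {t : Fin n} (ht : t ∉ A)
    {f : MvPolynomial (Fin n) K} : f * X t ∈ variableIdeal K A ↔ f ∈ variableIdeal K A := by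
  refine ⟨fun h => ?_, fun h => Ideal.mul_mem_right _ _ h⟩
  rw [mem_variableIdeal] at h ⊢
  intro e he
  obtain ⟨i, hi, hne⟩ := h (e + Finsupp.single t 1) (by
    rw [support_mul_X]
    exact Finset.mem_map.2 ⟨e, he, rfl⟩)
  refine ⟨i, hi, ?_⟩
  have hit : i ≠ t := fun h => ht (h ▸ hi)
  simpa [hit] using hne

/-- The variables form a regular sequence. -/
theorem isRegular_variables :
    RingTheory.Sequence.IsRegular (MvPolynomial (Fin n) K)
      (List.ofFn fun i : Fin n => (X i : MvPolynomial (Fin n) K)) := by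
  have hle : ∀ l : List (MvPolynomial (Fin n) K),
      (Ideal.ofList l • ⊤ : Submodule (MvPolynomial (Fin n) K) (MvPolynomial (Fin n) K)) =
        Ideal.ofList l := fun l => by rw [smul_eq_mul, Ideal.mul_top]
  refine ⟨⟨fun i hi => ?_⟩, fun h => ?_⟩
  · rw [List.length_ofFn] at hi
    have htake : Ideal.ofList ((List.ofFn fun i : Fin n => (X i : MvPolynomial (Fin n) K)).take i) =
        variableIdeal K {j | j.val < i} := by
      rw [Ideal.ofList, variableIdeal]
      congr 1
      ext f
      simp only [Set.mem_ofPred_eq, List.mem_take_iff_getElem, List.getElem_ofFn, List.length_ofFn,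
        Set.mem_image]
      constructor
      · rintro ⟨j, hj, rfl⟩
        exact ⟨⟨j, by omega⟩, by simp; omega, rfl⟩
      · rintro ⟨j, hj, rfl⟩
        exact ⟨j.val, by have := j.isLt; have : j.val < i := hj; omega, rfl⟩
    rw [List.getElem_ofFn, hle, htake, isSMulRegular_iff_right_eq_zero_of_smul]
    intro x hx
    obtain ⟨f, rfl⟩ := Submodule.mkQ_surjective _ x
    rw [Submodule.mkQ_apply, ← Submodule.Quotient.mk_smul, Submodule.Quotient.mk_eq_zero,
      smul_eq_mul, mul_comm, mul_X_mem_variableIdeal (by simp)] at hx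
    rwa [Submodule.mkQ_apply, Submodule.Quotient.mk_eq_zero]
  · rw [hle] at h
    have h1 : (1 : MvPolynomial (Fin n) K) ∈ variableIdeal K (Set.univ : Set (Fin n)) := by
      have : (1 : MvPolynomial (Fin n) K) ∈ Ideal.ofList
          (List.ofFn fun i : Fin n => (X i : MvPolynomial (Fin n) K)) := h ▸ Submodule.mem_top
      refine Ideal.span_mono ?_ this
      intro f hf
      obtain ⟨i, rfl⟩ := (List.mem_ofFn' _ _).1 hf
      exact ⟨i, trivial, rfl⟩
    rw [mem_variableIdeal] at h1
    obtain ⟨i, -, hi⟩ := h1 0 (by simp)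
    exact hi rfl

variable (K n) in
/-- The residue field of `𝔪` as an `S`-module. -/
noncomputable abbrev residueModule : ModuleCat.{u} (MvPolynomial (Fin n) K) :=
  ModuleCat.of _ (MvPolynomial (Fin n) K ⧸ gradedMaximalIdeal K n)

theorem support_residueModule : Module.support (MvPolynomial (Fin n) K) (residueModule K n) =
    PrimeSpectrum.zeroLocus (gradedMaximalIdeal K n : Set (MvPolynomial (Fin n) K)) := by
  rw [Module.support_eq_zeroLocus, Ideal.annihilator_quotient]

theorem gradedMaximalIdeal_eq : gradedMaximalIdeal K n = variableIdeal K Set.univ := by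
  rw [gradedMaximalIdeal, variableIdeal, Set.image_univ]

theorem gradedMaximalIdeal_ne_top : gradedMaximalIdeal K n ≠ ⊤ := by
  rw [gradedMaximalIdeal_eq, Ideal.ne_top_iff_one, mem_variableIdeal]
  intro h
  obtain ⟨i, -, hi⟩ := h 0 (by simp)
  exact hi rfl

theorem smul_top_quotient_lt_top {J : Ideal (MvPolynomial (Fin n) K)}
    (hJ : J ≤ gradedMaximalIdeal K n) :
    gradedMaximalIdeal K n •
      (⊤ : Submodule (MvPolynomial (Fin n) K) (MvPolynomial (Fin n) K ⧸ J)) < ⊤ := by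
  refine lt_top_iff_ne_top.2 fun h => gradedMaximalIdeal_ne_top (K := K) (n := n) ?_
  rw [← Submodule.range_mkQ J, LinearMap.range_eq_map, ← Submodule.map_smul'', smul_eq_mul,
    Ideal.mul_top] at h
  obtain ⟨f, hf, hf1⟩ : Submodule.mkQ J 1 ∈ Submodule.map (Submodule.mkQ J)
      (gradedMaximalIdeal K n) := h ▸ ⟨1, trivial, rfl⟩
  rw [Submodule.mkQ_apply, Submodule.mkQ_apply, Submodule.Quotient.eq] at hf1
  rw [Ideal.eq_top_iff_one, ← sub_sub_cancel f 1]
  exact Submodule.sub_mem _ hf (hJ hf1)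

theorem extVanishes_quotient_of_eq_bot {J : Ideal (MvPolynomial (Fin n) K)} (hJ : J = ⊥) :
    ExtVanishes (residueModule K n) n (MvPolynomial (Fin n) K ⧸ J) := by
  have h := ModuleCat.subsingleton_ext_of_exists_isRegular (gradedMaximalIdeal K n)
    (residueModule K n) support_residueModule.subset
    (ModuleCat.of _ (MvPolynomial (Fin n) K ⧸ J)) (smul_top_quotient_lt_top (hJ ▸ bot_le)) _ ?_
    (((Submodule.quotEquivOfEqBot J hJ).isRegular_congr _).2 isRegular_variables)
  · rwa [List.length_ofFn] at h
  · intro f hf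
    obtain ⟨i, rfl⟩ := (List.mem_ofFn' _ _).1 hf
    exact Ideal.subset_span ⟨i, rfl⟩

theorem extVanishes_variableIdeal (A : Finset (Fin n)) :
    ExtVanishes (residueModule K n) (n - A.card)
      (MvPolynomial (Fin n) K ⧸ variableIdeal K (A : Set (Fin n))) := by
  induction A using Finset.induction_on with
  | empty => exact (extVanishes_quotient_of_eq_bot (by simp [variableIdeal])).mono (Nat.sub_le _ _)
  | insert t A ht ih =>
    have hcard : n - (insert t A).card + 1 = n - A.card := by
      have h1 := Finset.card_insert_of_notMem ht
      have h2 := Finset.card_le_univ (insert t A)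
      rw [Fintype.card_fin] at h2
      omega
    have h : variableIdeal K ((insert t A : Finset (Fin n)) : Set (Fin n)) =
        variableIdeal K (A : Set (Fin n)) ⊔ Ideal.span {X t} := by
      rw [variableIdeal, variableIdeal, ← Ideal.span_union, Finset.coe_insert,
        Set.image_insert_eq, Set.union_singleton]
    rw [h]
    exact ExtVanishes.quotient_sup_span
      (fun f => (mul_X_mem_variableIdeal (by simpa using ht)).symm) (hcard ▸ ih)
      (ih.mono (by omega))

/-- The colon ideal of `x^b` by the lexicographically larger monomials of `G` is generated by
variables. -/
theorem mul_monomial_mem_monomialIdeal {G : Set (Fin n →₀ ℕ)} (hG : ExchangeProperty G)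
    {b : Fin n →₀ ℕ} (hb : b ∈ G) {f : MvPolynomial (Fin n) K} :
    f ∈ variableIdeal K (liftable G b : Set (Fin n)) ↔
      f * monomial b 1 ∈ monomialIdeal K {a ∈ G | toLex b < toLex a} := by
  rw [mem_variableIdeal, mem_monomialIdeal]
  have hsupp : ∀ e, e ∈ (f * monomial b 1).support ↔ ∃ w ∈ f.support, e = w + b := by
    intro e
    rw [mem_support_iff, coeff_mul_monomial']
    constructor
    · intro h
      split_ifs at h with hbe
      · exact ⟨e - b, mem_support_iff.2 (by simpa using h), (tsub_add_cancel_of_le hbe).symm⟩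
      · exact absurd rfl h
    · rintro ⟨w, hw, rfl⟩
      simpa using hw
  constructor
  · intro h e he
    obtain ⟨w, hw, rfl⟩ := (hsupp e).1 he
    obtain ⟨t, ht, hwt⟩ := h w hw
    obtain ⟨j, htj, -, hmem⟩ := mem_liftable.1 (by simpa using ht)
    refine ⟨raise b t j, ⟨hmem, toLex_lt_raise b htj⟩, fun i => ?_⟩
    rw [Finsupp.add_apply]
    by_cases hit : i = t
    · subst hit
      rw [raise_apply_self b htj]
      omega
    · exact (raise_apply_le b j hit).trans (Nat.le_add_left _ _)
  · intro h w hw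
    obtain ⟨a, ⟨ha, hlt⟩, hle⟩ := h (w + b) ((hsupp _).2 ⟨w, hw, rfl⟩)
    obtain ⟨t, heq, ht⟩ := Finsupp.Lex.lt_iff.1 hlt
    have heq' : ∀ i < t, a i = b i := fun i hi => (heq i hi).symm
    have ht' : b t < a t := ht
    refine ⟨t, by simpa using hG.mem_liftable ha hb heq' ht', ?_⟩
    have := hle t
    rw [Finsupp.add_apply] at this
    omega

theorem extVanishes_monomialIdeal_insert {G : Set (Fin n →₀ ℕ)} (hG : ExchangeProperty G)
    {b : Fin n →₀ ℕ} (hb : b ∈ G) {k : ℕ} (hk : k + 1 ≤ n - (liftable G b).card)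
    (h : ExtVanishes (residueModule K n) k
      (MvPolynomial (Fin n) K ⧸ monomialIdeal K {a ∈ G | toLex b < toLex a})) :
    ExtVanishes (residueModule K n) k
      (MvPolynomial (Fin n) K ⧸ monomialIdeal K (insert b {a ∈ G | toLex b < toLex a})) := by
  have hins : monomialIdeal K (insert b {a ∈ G | toLex b < toLex a}) =
      monomialIdeal K {a ∈ G | toLex b < toLex a} ⊔ Ideal.span {monomial b 1} := by
    rw [monomialIdeal, monomialIdeal, ← Ideal.span_union, Set.union_singleton, Set.image_insert_eq]
  rw [hins]
  have hC : ∀ f : MvPolynomial (Fin n) K, f ∈ variableIdeal K (liftable G b : Set (Fin n)) ↔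
      f * monomial b 1 ∈ monomialIdeal K {a ∈ G | toLex b < toLex a} :=
    fun f => mul_monomial_mem_monomialIdeal hG hb
  exact ExtVanishes.quotient_sup_span hC ((extVanishes_variableIdeal _).mono hk) h

theorem extVanishes_monomialIdeal {G : Set (Fin n →₀ ℕ)} (hG : ExchangeProperty G)
    (hfin : G.Finite) {q : ℕ} (hq : ∀ b ∈ G, (liftable G b).card ≤ q) :
    ExtVanishes (residueModule K n) (n - (q + 1)) (MvPolynomial (Fin n) K ⧸ monomialIdeal K G) := by
  classical
  rcases le_or_gt n (q + 1) with hn | hn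
  · rw [Nat.sub_eq_zero_of_le hn]
    exact fun i hi => absurd hi (Nat.not_lt_zero i)
  -- the generators are adjoined in lexicographically decreasing order
  have key : ∀ H : Finset (Lex (Fin n →₀ ℕ)), (∀ a ∈ H, ofLex a ∈ G) →
      (∀ a ∈ H, ∀ b ∈ G, a ≤ toLex b → toLex b ∈ H) →
      ExtVanishes (residueModule K n) (n - (q + 1))
        (MvPolynomial (Fin n) K ⧸ monomialIdeal K (toLex ⁻¹' (H : Set (Lex (Fin n →₀ ℕ))))) := by
    intro H
    induction H using Finset.induction_on_min with
    | empty =>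
      intro _ _
      exact (extVanishes_quotient_of_eq_bot (by simp [monomialIdeal])).mono (Nat.sub_le _ _)
    | insert b H hb ih =>
      obtain ⟨b, rfl⟩ := toLex.surjective b
      intro hHG hup
      have hbG : b ∈ G := hHG _ (Finset.mem_insert_self _ _)
      have ih' := ih (fun a ha => hHG a (Finset.mem_insert_of_mem ha)) fun a ha c hc hac =>
        Finset.mem_of_mem_insert_of_ne (hup a (Finset.mem_insert_of_mem ha) c hc hac)
          ((hb a ha).trans_le hac).ne'
      have hH : toLex ⁻¹' (H : Set (Lex (Fin n →₀ ℕ))) = {a ∈ G | toLex b < toLex a} := by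
        ext a
        constructor
        · intro ha
          exact ⟨hHG (toLex a) (Finset.mem_insert_of_mem ha), hb _ ha⟩
        · rintro ⟨ha, hba⟩
          exact Finset.mem_of_mem_insert_of_ne (hup _ (Finset.mem_insert_self _ _) a ha hba.le)
            hba.ne'
      have hpre : toLex ⁻¹' ((insert (toLex b) H : Finset _) : Set (Lex (Fin n →₀ ℕ))) =
          insert b (toLex ⁻¹' (H : Set (Lex (Fin n →₀ ℕ)))) := by
        ext a
        simp
      rw [hpre, hH]
      rw [hH] at ih'
      have h1 := hq _ hbG
      exact extVanishes_monomialIdeal_insert hG hbG (by omega) ih'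
  have h := key (hfin.toFinset.image toLex) (fun a ha => ?_) fun a _ b hb _ => ?_
  · have hGH : toLex ⁻¹' ((hfin.toFinset.image toLex : Finset (Lex (Fin n →₀ ℕ))) :
        Set (Lex (Fin n →₀ ℕ))) = G := by
      ext a
      simp
    rwa [hGH] at h
  · obtain ⟨c, hc, rfl⟩ := Finset.mem_image.1 ha
    exact hfin.mem_toFinset.1 hc
  · exact Finset.mem_image.2 ⟨b, hfin.mem_toFinset.2 hb, rfl⟩

theorem monomialIdeal_le_gradedMaximalIdeal {G : Set (Fin n →₀ ℕ)} (htop : monomialIdeal K G ≠ ⊤) :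
    monomialIdeal K G ≤ gradedMaximalIdeal K n := by
  rw [monomialIdeal, Ideal.span_le]
  rintro _ ⟨a, ha, rfl⟩
  rw [SetLike.mem_coe, gradedMaximalIdeal_eq, mem_variableIdeal]
  intro e he
  obtain rfl : e = a := by simpa using support_monomial_subset he
  by_contra! hzero
  obtain rfl : e = 0 := Finsupp.ext fun i => hzero i trivial
  exact htop ((Ideal.eq_top_iff_one _).2 (Ideal.subset_span ⟨0, ha, rfl⟩))

theorem le_depth_of_extVanishes {J : Ideal (MvPolynomial (Fin n) K)}
    (hJ : J ≤ gradedMaximalIdeal K n) {k : ℕ}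
    (h : ExtVanishes (residueModule K n) k (MvPolynomial (Fin n) K ⧸ J)) :
    (k : ℕ∞) ≤ depth K n (MvPolynomial (Fin n) K ⧸ J) := by
  obtain ⟨rs, hlen, hmem, hreg⟩ := ModuleCat.exists_isRegular_of_exists_subsingleton_ext
    (gradedMaximalIdeal K n) k (ModuleCat.of _ (MvPolynomial (Fin n) K ⧸ J))
    (smul_top_quotient_lt_top hJ) (residueModule K n) support_residueModule h
  rw [← hlen]
  exact le_iSup₂_of_le rs ⟨hmem, hreg⟩ le_rfl

end Depth

/-! ### Krull dimension and algebraically independent elements -/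

section KrullDim

/-- Chains of primes lift along integral extensions, by lying over and going up. -/
theorem ringKrullDim_le_of_isIntegral {R S : Type*} [CommRing R] [CommRing S] [Algebra R S]
    [Algebra.IsIntegral R S] (hinj : Function.Injective (algebraMap R S)) :
    ringKrullDim R ≤ ringKrullDim S := by
  refine iSup_le fun l => ?_
  have hP : ∃ P : Ideal S, P.IsPrime ∧ P.comap (algebraMap R S) = l.head.asIdeal := by
    obtain ⟨P, -, hP, h⟩ := Ideal.exists_ideal_over_prime_of_isIntegral l.head.asIdeal (⊥ : Ideal S)
      (by rw [Ideal.comap_bot_of_injective _ hinj]; exact bot_le)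
    exact ⟨P, hP, h⟩
  obtain ⟨P, hP, h⟩ := hP
  have : P.LiesOver l.head.asIdeal := ⟨h.symm⟩
  obtain ⟨L, hL, -⟩ := Ideal.exists_ltSeries_of_hasGoingUp (S := S) l P
  exact hL ▸ le_iSup (fun p : LTSeries (PrimeSpectrum S) => (p.length : WithBot ℕ∞)) L

theorem ringKrullDim_lt_top_of_finiteType (K : Type*) {A : Type*} [Field K] [CommRing A]
    [Algebra K A] [Algebra.FiniteType K A] : ringKrullDim A < ⊤ := by
  obtain ⟨m, f, hf⟩ := Algebra.FiniteType.iff_quotient_mvPolynomial''.1 ‹Algebra.FiniteType K A›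
  refine (ringKrullDim_le_of_surjective f.toRingHom hf).trans_lt ?_
  rw [MvPolynomial.ringKrullDim_of_isNoetherianRing, ringKrullDim_eq_zero_of_field, zero_add]
  exact WithBot.coe_lt_coe.2 (ENat.natCast_lt_top _)

variable {K A : Type*} [Field K] [CommRing A] [Algebra K A] [Algebra.FiniteType K A]

theorem algebraicIndependent_mk {K A ι : Type*} [Field K] [CommRing A] [Algebra K A] {J : Ideal A}
    {y : ι → A} (h : ∀ f : MvPolynomial ι K, aeval y f ∈ J → f = 0) :
    AlgebraicIndependent K fun i => Ideal.Quotient.mk J (y i) := by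
  rw [algebraicIndependent_iff]
  intro f hf
  have h1 : aeval (fun i => Ideal.Quotient.mk J (y i)) f = Ideal.Quotient.mkₐ K J (aeval y f) :=
    (comp_aeval_apply y (Ideal.Quotient.mkₐ K J) f).symm
  rw [h1, Ideal.Quotient.mkₐ_eq_mk, Ideal.Quotient.eq_zero_iff_mem] at hf
  exact h f hf

theorem card_le_ringKrullDim_of_isDomain [IsDomain A] {ι : Type*} [Fintype ι] {y : ι → A}
    (hy : AlgebraicIndependent K y) : (Fintype.card ι : WithBot ℕ∞) ≤ ringKrullDim A := by
  obtain ⟨s, g, hg, hint⟩ := exists_integral_inj_algHom_of_fg K A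
  algebraize [g.toRingHom]
  have hint' : Algebra.IsIntegral (MvPolynomial (Fin s) K) A := ⟨hint⟩
  have h1 : (s : WithBot ℕ∞) ≤ ringKrullDim A := by
    have := ringKrullDim_le_of_isIntegral (R := MvPolynomial (Fin s) K) (S := A) hg
    rwa [MvPolynomial.ringKrullDim_of_isNoetherianRing, ringKrullDim_eq_zero_of_field, zero_add,
      Nat.card_eq_fintype_card, Fintype.card_fin] at this
  have h2 : Fintype.card ι ≤ s := by
    have : IsScalarTower K (MvPolynomial (Fin s) K) A :=
      IsScalarTower.of_algebraMap_eq fun r => (g.commutes r).symm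
    have : FaithfulSMul (MvPolynomial (Fin s) K) A := (faithfulSMul_iff_algebraMap_injective _ _).2 hg
    have htr := lift_trdeg_add_eq K (MvPolynomial (Fin s) K) A
    rw [trdeg_eq_zero (R := MvPolynomial (Fin s) K), MvPolynomial.trdeg_of_isDomain, Cardinal.mk_fin] at htr
    have hle := hy.lift_cardinalMk_le_trdeg
    rw [Cardinal.mk_fintype, Cardinal.lift_natCast] at hle
    have hs : Algebra.trdeg K A = s := by simpa using htr.symm
    rw [hs] at hle
    simpa using hle
  exact le_trans (by exact_mod_cast h2) h1

/-- The Krull dimension of a finitely generated algebra over a field is at least the number of any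
algebraically independent elements. -/
theorem card_le_ringKrullDim {ι : Type*} [Fintype ι] {y : ι → A}
    (hy : AlgebraicIndependent K y) : (Fintype.card ι : WithBot ℕ∞) ≤ ringKrullDim A := by
  -- some prime of `A` meets the polynomial ring `K[y]` in zero
  obtain ⟨p, hp, hcomap⟩ := Ideal.exists_comap_eq_of_mem_minimalPrimes_of_injective
    (f := (aeval y : MvPolynomial ι K →ₐ[K] A).toRingHom) hy ⊥
    (by rw [IsDomain.minimalPrimes_eq_singleton_bot]; rfl)
  have hy' : AlgebraicIndependent K fun i => Ideal.Quotient.mk p (y i) :=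
    algebraicIndependent_mk fun f hf => by
      have h : f ∈ (⊥ : Ideal (MvPolynomial ι K)) := hcomap ▸ hf
      simpa using h
  have : Algebra.FiniteType K (A ⧸ p) :=
    Algebra.FiniteType.of_surjective (Ideal.Quotient.mkₐ K p) (Ideal.Quotient.mkₐ_surjective K p)
  exact (card_le_ringKrullDim_of_isDomain hy').trans (ringKrullDim_quotient_le p)

end KrullDim

/-! ### The analytic spread -/

section FibreRing

variable {K : Type*} [Field K] {n : ℕ} {I : Ideal (MvPolynomial (Fin n) K)}

theorem finiteType_fibreRing : Algebra.FiniteType K (FibreRing I) := by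
  have h1 : Algebra.FiniteType K (reesAlgebra I) :=
    Algebra.FiniteType.trans (S := MvPolynomial (Fin n) K) inferInstance inferInstance
  exact Algebra.FiniteType.of_surjective (Ideal.Quotient.mkₐ K _) (Ideal.Quotient.mkₐ_surjective K _)

/-- The elements of the extension of `J` to the Rees algebra have `t^k`-coefficients in `J I^k`. -/
theorem coeff_mem_of_mem_map {J : Ideal (MvPolynomial (Fin n) K)} {f : reesAlgebra I}
    (hf : f ∈ J.map (algebraMap (MvPolynomial (Fin n) K) (reesAlgebra I))) (k : ℕ) :
    f.1.coeff k ∈ J * I ^ k := by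
  rw [Ideal.map] at hf
  induction hf using Submodule.span_induction generalizing k with
  | mem x hx =>
    obtain ⟨r, hr, rfl⟩ := hx
    change (Polynomial.C r).coeff k ∈ _
    rw [Polynomial.coeff_C]
    split_ifs with hk
    · subst hk
      simpa using hr
    · exact Submodule.zero_mem _
  | zero => exact Submodule.zero_mem _
  | add x y _ _ hx hy =>
    change (x.1 + y.1).coeff k ∈ _
    rw [Polynomial.coeff_add]
    exact Submodule.add_mem _ (hx k) (hy k)
  | smul a x _ hx =>
    change (a.1 * x.1).coeff k ∈ _
    rw [Polynomial.coeff_mul]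
    refine Ideal.sum_mem _ fun p hp => ?_
    rw [← Finset.HasAntidiagonal.mem_antidiagonal.1 hp, pow_add, mul_left_comm]
    exact Ideal.mul_mem_mul (a.2 p.1) (hx p.2)

theorem prod_monomial_monomial {ι : Type*} (s : Finset ι) (k : ι → ℕ) (e : ι → Fin n →₀ ℕ) :
    ∏ o ∈ s, Polynomial.monomial (k o) (monomial (e o) 1 : MvPolynomial (Fin n) K) =
      Polynomial.monomial (∑ o ∈ s, k o) (monomial (∑ o ∈ s, e o) 1) := by
  classical
  induction s using Finset.induction_on with
  | empty => rfl
  | insert o s ho ih =>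
    rw [Finset.prod_insert ho, ih, Finset.sum_insert ho, Finset.sum_insert ho,
      Polynomial.monomial_mul_monomial, monomial_mul, one_mul]

/-- The element `x^a t` of the Rees algebra. -/
noncomputable def reesMonomial (a : Fin n →₀ ℕ)
    (ha : (monomial a 1 : MvPolynomial (Fin n) K) ∈ I) : reesAlgebra I :=
  ⟨Polynomial.monomial 1 (monomial a 1), reesAlgebra.monomial_mem.2 (by simpa using ha)⟩

theorem coe_aeval_reesMonomial {ι : Type*} [Fintype ι] {a : ι → Fin n →₀ ℕ}
    (ha : ∀ o, (monomial (a o) 1 : MvPolynomial (Fin n) K) ∈ I) (f : MvPolynomial ι K) :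
    (aeval (fun o => reesMonomial (a o) (ha o)) f).1 = ∑ m ∈ f.support,
      Polynomial.monomial m.degree (monomial (∑ o, m o • a o) (coeff m f)) := by
  have h : (aeval (fun o => reesMonomial (a o) (ha o)) f).1 = aeval
      (fun o => Polynomial.monomial 1 (monomial (a o) 1 : MvPolynomial (Fin n) K)) f :=
    comp_aeval_apply _ ((reesAlgebra I).val.restrictScalars K) f
  rw [h, aeval_def, eval₂_eq']
  refine Finset.sum_congr rfl fun m _ => ?_
  simp only [Polynomial.monomial_pow, monomial_pow, one_pow, one_mul]
  rw [prod_monomial_monomial, Polynomial.algebraMap_apply, MvPolynomial.algebraMap_eq,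
    Polynomial.C_mul_monomial, C_mul_monomial, mul_one, Finsupp.degree_eq_sum]

theorem coeff_coeff_aeval_reesMonomial {ι : Type*} [Fintype ι] {a : ι → Fin n →₀ ℕ}
    (ha : ∀ o, (monomial (a o) 1 : MvPolynomial (Fin n) K) ∈ I)
    (hinj : ∀ m m' : ι →₀ ℕ, m.degree = m'.degree → ∑ o, m o • a o = ∑ o, m' o • a o → m = m')
    (f : MvPolynomial ι K) (m : ι →₀ ℕ) :
    coeff (∑ o, m o • a o)
      ((aeval (fun o => reesMonomial (a o) (ha o)) f).1.coeff m.degree) = coeff m f := by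
  classical
  rw [coe_aeval_reesMonomial, Polynomial.finsetSum_coeff, coeff_sum, Finset.sum_eq_single m]
  · rw [Polynomial.coeff_monomial, if_pos rfl, coeff_monomial, if_pos rfl]
  · intro m' _ hm'
    rw [Polynomial.coeff_monomial]
    split_ifs with hk
    · rw [coeff_monomial, if_neg]
      exact fun h => hm' (hinj _ _ hk h)
    · rfl
  · intro hm
    rw [notMem_support_iff.1 hm]
    simp

/-- Monomials of the common generating degree `d` whose exponent vectors are affinely independent
(stated here as: a multiset of them is determined by its size and its sum) have algebraically
independent classes in the fibre ring. Indeed a polynomial in them has degree `d k` in the `x_i`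
wherever it has degree `k` in `t`, while those of `𝔪 R(I)` have larger degree there. -/
theorem algebraicIndependent_fibreRing {ι : Type*} [Fintype ι] {d : ℕ}
    (hI : I ≤ idealOfVars (Fin n) K ^ d) (a : ι → Fin n →₀ ℕ)
    (ha : ∀ o, (monomial (a o) 1 : MvPolynomial (Fin n) K) ∈ I) (hdeg : ∀ o, (a o).degree = d)
    (hinj : ∀ m m' : ι →₀ ℕ, m.degree = m'.degree → ∑ o, m o • a o = ∑ o, m' o • a o → m = m') :
    AlgebraicIndependent K fun o =>
      (Ideal.Quotient.mk _ (reesMonomial (a o) (ha o)) : FibreRing I) := by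
  refine algebraicIndependent_mk fun f hf => ?_
  by_contra hne
  obtain ⟨m, hm⟩ := support_nonempty.2 hne
  have h2 : (aeval (fun o => reesMonomial (a o) (ha o)) f).1.coeff m.degree ∈
      idealOfVars (Fin n) K ^ (d * m.degree + 1) := by
    rw [pow_succ', pow_mul]
    exact Ideal.mul_mono_right (Ideal.pow_right_mono hI _) (coeff_mem_of_mem_map hf m.degree)
  rw [mem_pow_idealOfVars_iff'] at h2
  refine mem_support_iff.1 hm ((coeff_coeff_aeval_reesMonomial ha hinj f m).symm.trans (h2 _ ?_))
  rw [map_sum, Finsupp.degree_eq_sum, Finset.mul_sum]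
  simp only [map_nsmul, hdeg, smul_eq_mul, mul_comm d]
  exact Nat.lt_succ_self _

theorem exists_analyticSpread_eq (h : Nontrivial (FibreRing I)) :
    ∃ l : ℕ, analyticSpread I = l := by
  have := finiteType_fibreRing (I := I)
  have h1 := ringKrullDim_lt_top_of_finiteType K (A := FibreRing I)
  have h2 := ringKrullDim_nonneg_of_nontrivial (R := FibreRing I)
  rw [analyticSpread]
  generalize ringKrullDim (FibreRing I) = x at h1 h2
  induction x with
  | bot => simp at h2
  | coe x =>
    induction x with
    | top => exact absurd rfl h1.ne
    | coe l => exact ⟨l, rfl⟩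

end FibreRing

/-! ### Bounding the analytic spread by the colon ideals -/

section Bound

variable {n : ℕ}

/-- The vectors `e_t - e_{j t}` with `j t > t` are linearly independent over `ℤ`. -/
theorem eq_zero_of_sum_single_sub_single {A : Finset (Fin n)} {j : A → Fin n}
    (hj : ∀ t : A, t.1 < j t) {z : A → ℤ}
    (h : ∀ i : Fin n, ∑ t : A, z t * ((if t.1 = i then 1 else 0) - if j t = i then 1 else 0) = 0)
    (t : A) : z t = 0 := by
  obtain ⟨t, ht⟩ := t
  induction t using WellFoundedLT.induction with
  | ind t ih =>
    have h1 := h t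
    rw [Finset.sum_eq_single ⟨t, ht⟩] at h1
    · simpa [(hj ⟨t, ht⟩).ne'] using h1
    · rintro s - hs
      by_cases hst : j s = t
      · rw [ih s.1 (hst ▸ hj s) s.2, zero_mul]
      · have hne : s.1 ≠ t := fun h => hs (Subtype.ext h)
        simp [hst, hne]
    · exact fun h => absurd (Finset.mem_univ _) h

/-- The vector `b` together with the vectors `b + e_t - e_{j t}` for `t ∈ A`; it is used for `j t > t`
such that `x_{j t}` divides `x^b`. -/
noncomputable def raiseFamily (b : Fin n →₀ ℕ) {A : Finset (Fin n)} (j : A → Fin n) :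
    Option A → Fin n →₀ ℕ
  | none => b
  | some t => raise b t (j t)

theorem cast_raise (b : Fin n →₀ ℕ) (t : Fin n) {j : Fin n} (hj : 0 < b j) (i : Fin n) :
    (raise b t j i : ℤ) = b i + ((if t = i then 1 else 0) - if j = i then 1 else 0) := by
  rw [raise, Finsupp.add_apply, Finsupp.tsub_apply, Finsupp.single_apply, Finsupp.single_apply]
  by_cases hji : j = i
  · subst hji
    split_ifs <;> omega
  · simp [hji, add_comm]

theorem raiseFamily_affineIndependent {b : Fin n →₀ ℕ} {A : Finset (Fin n)} {j : A → Fin n}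
    (hj : ∀ t : A, t.1 < j t) (hb : ∀ t, 0 < b (j t)) (m m' : Option A →₀ ℕ)
    (hdeg : m.degree = m'.degree)
    (hsum : ∑ o, m o • raiseFamily b j o = ∑ o, m' o • raiseFamily b j o) : m = m' := by
  rw [Finsupp.degree_eq_sum, Finsupp.degree_eq_sum, Fintype.sum_option, Fintype.sum_option] at hdeg
  have hd : (m none : ℤ) - m' none + ∑ t : A, ((m (some t) : ℤ) - m' (some t)) = 0 := by
    rw [Finset.sum_sub_distrib]
    have : (m none : ℤ) + ∑ t : A, (m (some t) : ℤ) = m' none + ∑ t : A, (m' (some t) : ℤ) := by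
      exact_mod_cast hdeg
    linarith
  have hz : ∀ t : A, (m (some t) : ℤ) - m' (some t) = 0 := by
    refine eq_zero_of_sum_single_sub_single hj fun i => ?_
    have h1 := congrArg (fun f : Fin n →₀ ℕ => (f i : ℤ)) hsum
    simp only [Fintype.sum_option, raiseFamily, Finsupp.add_apply, Finsupp.finsetSum_apply,
      Finsupp.smul_apply, smul_eq_mul, Nat.cast_add, Nat.cast_sum, Nat.cast_mul] at h1
    simp only [cast_raise b _ (hb _), mul_add, Finset.sum_add_distrib, ← Finset.sum_mul] at h1
    simp only [sub_mul, Finset.sum_sub_distrib] at hd ⊢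
    linear_combination h1 - (b i : ℤ) * hd
  have hn : (m none : ℤ) - m' none = 0 := by
    simpa [hz] using hd
  ext o
  rcases o with _ | t
  · omega
  · have := hz t
    omega

variable {K : Type*} [Field K] {I : Ideal (MvPolynomial (Fin n) K)} {d : ℕ}

theorem le_pow_idealOfVars (hI : IsMonomialIdeal I)
    (hd : ∀ a ∈ minimalGenerators I, a.degree = d) : I ≤ idealOfVars (Fin n) K ^ d := by
  intro f hf
  rw [mem_pow_idealOfVars_iff]
  intro e he
  obtain ⟨a, ha, hae⟩ : e ∈ upset (minimalGenerators I) :=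
    exponents_eq_upset I ▸ hI.mem_iff.1 hf e he
  exact hd a ha ▸ Finsupp.degree_mono hae

theorem nontrivial_fibreRing (hI : IsMonomialIdeal I)
    (hd : ∀ a ∈ minimalGenerators I, a.degree = d) : Nontrivial (FibreRing I) := by
  -- the empty family is algebraically independent in the fibre ring
  have h := algebraicIndependent_fibreRing (le_pow_idealOfVars hI hd)
    (fun o : Empty => o.elim) (fun o => o.elim) (fun o => o.elim) fun _ _ _ _ => Subsingleton.elim _ _
  exact (AlgebraicIndependent.algebraMap_injective h).nontrivial

theorem card_liftable_add_one_le (hI : IsMonomialIdeal I)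
    (hd : ∀ a ∈ minimalGenerators I, a.degree = d) {b : Fin n →₀ ℕ}
    (hb : b ∈ minimalGenerators I) {l : ℕ} (hl : analyticSpread I = l) :
    (liftable (minimalGenerators I) b).card + 1 ≤ l := by
  choose j hj hbj hmem using fun t : liftable (minimalGenerators I) b => mem_liftable.1 t.2
  have hG : ∀ o, raiseFamily b j o ∈ minimalGenerators I := by
    rintro (_ | t)
    · exact hb
    · exact hmem t
  have := finiteType_fibreRing (I := I)
  have h := card_le_ringKrullDim (algebraicIndependent_fibreRing (le_pow_idealOfVars hI hd)
    (raiseFamily b j) (fun o => monomial_mem_of_mem_minimalGenerators (hG o))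
    (fun o => hd _ (hG o)) (raiseFamily_affineIndependent hj hbj))
  rw [← analyticSpread, hl, Fintype.card_option, Fintype.card_coe] at h
  exact_mod_cast h

theorem IsMonomialIdeal.eq_monomialIdeal (hI : IsMonomialIdeal I) :
    I = monomialIdeal K (minimalGenerators I) := by
  ext f
  rw [hI.mem_iff, mem_monomialIdeal, exponents_eq_upset]

end Bound

end StanleyDepth

theorem corollary2p7 {K : Type*} [Field K] {n : ℕ} (I : Ideal (MvPolynomial (Fin n) K))
    (hI : StanleyDepth.IsWeaklyPolymatroidal I) (hd : StanleyDepth.GeneratedInSingleDegree I) :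
    ∃ l : ℕ, StanleyDepth.analyticSpread I = (l : WithBot ℕ∞) ∧
      (I ≠ ⊥ → (n : ℕ∞) + 1 ≤ StanleyDepth.sdepthIdeal I + l) ∧
      (I ≠ ⊤ → (n : ℕ∞) ≤ StanleyDepth.sdepthQuotient I + l) ∧
      (I ≠ ⊤ → (n : ℕ∞) ≤ StanleyDepth.depth K n (MvPolynomial (Fin n) K ⧸ I) + l) := by
  open StanleyDepth in
  obtain ⟨d, hd⟩ := hd
  have hG := hI.exchangeProperty hd
  have hfin := minimalGenerators_finite hd
  have := hfin.to_subtype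
  obtain ⟨l, hl⟩ := exists_analyticSpread_eq (nontrivial_fibreRing hI.1 hd)
  have hcard := fun b hb => card_liftable_add_one_le hI.1 hd (b := b) hb hl
  -- in `n + 1 - l` and `n - l` the subtraction may be truncated; `n ≤ (n - l) + l` holds all the same
  refine ⟨l, hl, fun _ => ?_, fun _ => ?_, fun htop => ?_⟩
  · have h : ((n + 1 - l : ℕ) : ℕ∞) ≤ sdepthIdeal I := by
      have hpart := hG.isBoxPartition_upset hfin
      rw [← exponents_eq_upset] at hpart
      refine le_sdepthIdeal hI.1 hpart fun b => ?_
      have h1 := hcard b.1 b.2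
      have h2 := Finset.card_add_card_compl (liftable (minimalGenerators I) b.1)
      rw [Fintype.card_fin] at h2
      exact_mod_cast (show n + 1 - l ≤ _ by omega)
    calc (n : ℕ∞) + 1 ≤ ((n + 1 - l : ℕ) : ℕ∞) + l := by exact_mod_cast (by omega)
      _ ≤ _ := by gcongr
  · have h : ((n - l : ℕ) : ℕ∞) ≤ sdepthQuotient I := by
      rcases (minimalGenerators I).eq_empty_or_nonempty with hempty | hne
      · -- for `I = 0` the whole ring `S` is a Stanley space
        have hpart : IsBoxPartition (fun _ : Unit => (0 : Fin n →₀ ℕ)) (fun _ => Finset.univ)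
            (exponents I)ᶜ := by
          rw [exponents_eq_upset, hempty]
          exact ⟨fun e => ⟨fun _ => ⟨(), zero_le, by simp⟩, fun _ ⟨a, ha, _⟩ => ha⟩,
            fun _ _ _ _ _ => rfl⟩
        refine le_sdepthQuotient hI.1 hpart fun _ => ?_
        rw [Finset.card_fin]
        exact_mod_cast Nat.sub_le n l
      · have hpart := hG.isBoxPartition_compl_upset hfin hne
        rw [← exponents_eq_upset] at hpart
        have := (gapIndex_finite hfin).to_subtype
        refine le_sdepthQuotient hI.1 hpart fun p => ?_
        have h1 := hcard p.1.2.1 p.2.1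
        have h2 := card_le_card_gapFree_add (minimalGenerators I) p.1
        exact_mod_cast (show n - l ≤ _ by omega)
    calc (n : ℕ∞) ≤ ((n - l : ℕ) : ℕ∞) + l := by exact_mod_cast (by omega)
      _ ≤ _ := by gcongr
  · have h : ((n - l : ℕ) : ℕ∞) ≤ depth K n (MvPolynomial (Fin n) K ⧸ I) := by
      rcases (minimalGenerators I).eq_empty_or_nonempty with hempty | ⟨b, hb⟩
      · have hbot := hI.1.eq_bot_iff.2 hempty
        exact le_depth_of_extVanishes (hbot ▸ bot_le)
          ((extVanishes_quotient_of_eq_bot hbot).mono (Nat.sub_le n l))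
      · have hJ := hI.1.eq_monomialIdeal
        refine le_depth_of_extVanishes
          (hJ.le.trans (monomialIdeal_le_gradedMaximalIdeal (hJ ▸ htop))) ?_
        have hl : l - 1 + 1 = l := Nat.sub_add_cancel (le_trans (Nat.le_add_left _ _) (hcard b hb))
        have hext := extVanishes_monomialIdeal (K := K) hG hfin (q := l - 1)
          fun b hb => Nat.le_sub_of_add_le (hcard b hb)
        rwa [hl, ← hJ] at hext
    calc (n : ℕ∞) ≤ ((n - l : ℕ) : ℕ∞) + l := by exact_mod_cast (by omega)
      _ ≤ _ := by gcongr
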